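/- **Conventions.** For a metric space $M$ with base point $p$, $\mathrm{Lip}_0(M)$ is the space of real Lipschitz functions on $M$ vanishing at $p$, with the norm $\|f\|=\sup_{x\ne y}|f(x)-f(y)|/d(x,y)$; $\delta_x\in \mathrm{Lip}_0(M)^*$ is evaluation at $x$, and $\mathcal F(M)=\overline{\mathrm{span}}\{\delta_x : x\in M\}\subseteq \mathrm{Lip}_0(M)^*$. A *net* in $M$ is a subset that is $\alpha$-separated and $\beta$-dense in $M$ for some $\alpha,\beta>0$. A Schauder basis is *conditional* if it is not unconditional. **Lattice bases.** For $2\le d\le\infty$ let $\mathbb Z^{d}\subseteq c_0$ be the set of all integer-valued null sequences (so finitely supported) that vanish at the indices $i\ge d$ (indices start at $0$; for $d=\infty$ this is the integer lattice $\mathbb Z^{<\omega}$ of $c_0$), with the metric of $c_0$ and base point $0$. Let $\{0\}=B_0\subseteq B_1\subseteq\cdots$ be boxes $B_s=\{x\in\mathbb Z^d: -a_s(i)\le x_i\le b_s(i)\ \forall i\}$ with union $\mathbb Z^d$, where $a_s(i),b_s(i)\in\mathbb N_0$ and $0\le a_{s+1}(i)-a_s(i)\le 1$, $0\le b_{s+1}(i)-b_s(i)\le1$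 for all $s$ and $i$. Let $\mu_0=0,\mu_1,\mu_2,\dots$ be an enumeration without repetition of $\mathbb Z^d$ that lists the points of each $B_s$ before all points outside $B_s$, and let $\pi_s:\mathbb Z^d\to B_s$ be the coordinatewise nearest-point retraction. Let $\varphi_n:\mathbb Z^d\to\{\mu_0,\dots,\mu_n\}$ send $x$ to the last of the points $\pi_0(x),\pi_1(x),\dots$ (a sequence that is eventually equal to $x$) lying in $\{\mu_0,\dots,\mu_n\}$, where "last" refers to the indices $s$ not exceeding the least $s$ with $\pi_s(x)=x$. Put $e_n=\delta_{\mu_n}-\delta_{\varphi_{n-1}(\mu_n)}$, $n\ge1$. **Statement.** 1. For every $2\le d\le\infty$ such boxes and enumerations exist. For any choice of them, the $\varphi_n$ are uniformly Lipschitz retractions of $\mathbb Z^d$ with $\varphi_n(\mathbb Z^d)=\{\mu_0,\dots,\mu_n\}$ and $\varphi_m\varphi_n=\varphi_n\varphi_m=\varphi_n$ for $n\le m$; and $(e_n)_{n\ge1}$ is a conditional Schauder basis of $\mathcal F(\mathbb Z^d)$ whose projections $P_n$ satisfy $P_n^*f=f\circ\varphi_n$ for $f\in\mathrm{Lip}_0(\mathbb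 Z^d)$. 2. Let $N$, with any base point in $N$, be a net in $C(K)$, where $K$ is a metrizable compact space with at least two points, or a net in the positive cone $c_0^+=\{x\in c_0: x_i\ge0\ \forall i\}$. In the first case let $d$ be the number of points of $K$ if $K$ is finite and $d=\infty$ otherwise; in the second case let $d=\infty$. Every Hájek–Novotný basis of $\mathcal F(N)$, that is, every sequence $(c_nT e_n)_{n\ge1}$ with $(e_n)$ as above in $\mathcal F(\mathbb Z^d)$, $T:\mathcal F(\mathbb Z^d)\to\mathcal F(N)$ a linear isomorphism (onto, bounded in both directions) and scalars $c_n\ne0$, is a conditional Schauder basis of $\mathcal F(N)$. -/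

import Mathlib

open scoped ZeroAtInfty

noncomputable section

namespace FreeBasis

/-! ### Lipschitz-free spaces -/

section LipFree

variable {M : Type*} [MetricSpace M]

/-- The real Lipschitz functions on `M` that vanish at the base point `p`, as a vector space. -/
def lip0Submodule (p : M) : Submodule ℝ (M → ℝ) where
  carrier := {f | (∃ C, LipschitzWith C f) ∧ f p = 0}
  zero_mem' := ⟨⟨0, LipschitzWith.const 0⟩, rfl⟩
  add_mem' := by
    rintro f g ⟨⟨C, hf⟩, hf0⟩ ⟨⟨D, hg⟩, hg0⟩
    exact ⟨⟨C + D, hf.add hg⟩, by simp [hf0, hg0]⟩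
  smul_mem' := by
    rintro c f ⟨⟨C, hf⟩, hf0⟩
    refine ⟨⟨‖c‖₊ * C, ?_⟩, by simp [hf0]⟩
    exact (lipschitzWith_smul c).comp hf

/-- The space `Lip₀(M)`, a type of its own, so that it carries the Lipschitz norm and not the
topology of pointwise convergence. -/
def Lip0 (p : M) : Type _ := ↥(lip0Submodule p)

instance (p : M) : AddCommGroup (Lip0 p) := inferInstanceAs (AddCommGroup ↥(lip0Submodule p))

instance (p : M) : Module ℝ (Lip0 p) := inferInstanceAs (Module ℝ ↥(lip0Submodule p))

instance (p : M) : FunLike (Lip0 p) M ℝ where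
  coe f := f.1
  coe_injective := Subtype.val_injective

namespace Lip0

variable {p : M}

theorem lipschitz (f : Lip0 p) : ∃ C, LipschitzWith C (f : M → ℝ) := f.2.1

@[simp] theorem map_base (f : Lip0 p) : f p = 0 := f.2.2

@[simp] theorem add_apply (f g : Lip0 p) (x : M) : (f + g) x = f x + g x := rfl

@[simp] theorem smul_apply (c : ℝ) (f : Lip0 p) (x : M) : (c • f) x = c * f x := rfl

@[simp] theorem zero_apply (x : M) : (0 : Lip0 p) x = 0 := rfl

/-- The Lipschitz norm `sup_{x ≠ y} |f x - f y| / d(x, y)` (the terms with `x = y` are `0`). -/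
instance : Norm (Lip0 p) where
  norm f := ⨆ q : M × M, |f q.1 - f q.2| / dist q.1 q.2

theorem norm_def (f : Lip0 p) : ‖f‖ = ⨆ q : M × M, |f q.1 - f q.2| / dist q.1 q.2 := rfl

theorem bddAbove (f : Lip0 p) :
    BddAbove (Set.range fun q : M × M => |f q.1 - f q.2| / dist q.1 q.2) := by
  obtain ⟨C, hC⟩ := f.lipschitz
  refine ⟨C, ?_⟩
  rintro _ ⟨q, rfl⟩
  refine div_le_of_le_mul₀ dist_nonneg C.2 ?_
  simpa [Real.dist_eq] using hC.dist_le_mul q.1 q.2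

theorem norm_nonneg' (f : Lip0 p) : 0 ≤ ‖f‖ :=
  Real.iSup_nonneg fun _ => div_nonneg (abs_nonneg _) dist_nonneg

theorem abs_sub_le (f : Lip0 p) (x y : M) : |f x - f y| ≤ ‖f‖ * dist x y := by
  rcases eq_or_ne x y with rfl | h
  · simp
  · rw [← div_le_iff₀ (dist_pos.2 h)]
    exact le_ciSup f.bddAbove (x, y)

theorem norm_le (f : Lip0 p) {C : ℝ} (hC : 0 ≤ C) (h : ∀ x y, |f x - f y| ≤ C * dist x y) :
    ‖f‖ ≤ C :=
  Real.iSup_le (fun q => div_le_of_le_mul₀ dist_nonneg hC (h q.1 q.2)) hC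

theorem normedSpaceCore (p : M) : NormedSpace.Core ℝ (Lip0 p) where
  norm_nonneg := norm_nonneg'
  norm_smul c f := by
    simp only [norm_def, smul_apply, ← mul_sub, abs_mul, mul_div_assoc]
    rw [Real.norm_eq_abs, Real.mul_iSup_of_nonneg (abs_nonneg c)]
  norm_triangle f g := by
    refine norm_le _ (add_nonneg f.norm_nonneg' g.norm_nonneg') fun x y => ?_
    have h : (f + g) x - (f + g) y = (f x - f y) + (g x - g y) := by
      simp only [add_apply]; ring
    rw [h, add_mul]
    exact (abs_add_le _ _).trans (add_le_add (f.abs_sub_le x y) (g.abs_sub_le x y))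
  norm_eq_zero_iff f := by
    constructor
    · intro h
      refine DFunLike.ext _ _ fun x => ?_
      have := f.abs_sub_le x p
      rw [h, zero_mul, map_base, sub_zero] at this
      simpa using this
    · rintro rfl
      simp [norm_def]

instance (p : M) : NormedAddCommGroup (Lip0 p) := NormedAddCommGroup.ofCore (normedSpaceCore p)

instance (p : M) : NormedSpace ℝ (Lip0 p) := NormedSpace.ofCore (normedSpaceCore p)

end Lip0

/-- The evaluation functional `δ_x` on `Lip₀(M)`. -/
def dirac (p x : M) : StrongDual ℝ (Lip0 p) :=
  LinearMap.mkContinuous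
    { toFun := fun f => f x, map_add' := fun _ _ => rfl, map_smul' := fun _ _ => rfl }
    (dist x p) fun f => by
      have h := f.abs_sub_le x p
      rw [Lip0.map_base, sub_zero, mul_comm] at h
      exact h

@[simp] theorem dirac_apply (p x : M) (f : Lip0 p) : dirac p x f = f x := rfl

/-- The norm-closed linear span of the evaluation functionals in the dual of `Lip₀(M)`. -/
def lipFreeSubmodule (p : M) : Submodule ℝ (StrongDual ℝ (Lip0 p)) :=
  (Submodule.span ℝ (Set.range (dirac p))).topologicalClosure

/-- The Lipschitz-free space of `M` with base point `p`, normed as a subspace of `Lip₀(M)*`. -/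
abbrev LipFree (p : M) : Type _ := ↥(lipFreeSubmodule p)

/-- `δ_x` as an element of the Lipschitz-free space. -/
def delta (p x : M) : LipFree p :=
  ⟨dirac p x, Submodule.le_topologicalClosure _ (Submodule.subset_span ⟨x, rfl⟩)⟩

end LipFree

/-! ### Conditional bases and retractional bases -/

section Bases

variable {X : Type*} [NormedAddCommGroup X] [NormedSpace ℝ X]

/-- The sequence `e` is a Schauder basis of `X`. -/
def IsSchauderBasis (e : ℕ → X) : Prop :=
  ∃ b : SchauderBasis ℝ X, ∀ n, b n = e n

/-- The sequence `e` is an unconditional Schauder basis of `X`: the expansion of every vector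
converges unconditionally. -/
def IsUnconditionalBasis (e : ℕ → X) : Prop :=
  ∃ b : UnconditionalSchauderBasis ℕ ℝ X, ∀ n, b n = e n

/-- A conditional basis is a Schauder basis that is not unconditional. -/
def IsConditionalBasis (e : ℕ → X) : Prop :=
  IsSchauderBasis e ∧ ¬ IsUnconditionalBasis e

variable {M : Type*} [MetricSpace M]

/-- Distinct points `μ 0 = p, μ 1, …` of `M` with dense union, and commuting, uniformly Lipschitz
retractions `φ n` of `M` onto `{μ 0, …, μ n}`. -/
structure IsRetractionSystem (p : M) (μ : ℕ → M) (φ : ℕ → M → M) : Prop where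
  injective : Function.Injective μ
  zero : μ 0 = p
  range_eq : ∀ n, Set.range (φ n) = μ '' Set.Iic n
  dense : DenseRange μ
  lipschitz : ∃ K, ∀ n, LipschitzWith K (φ n)
  comp : ∀ m n, n ≤ m → φ m ∘ φ n = φ n ∧ φ n ∘ φ m = φ n

/-- `e` is a Schauder basis of the Lipschitz-free space of `M` that arises from the retractions
`φ n`: the adjoint of its `n`-th projection `P n` is `f ↦ f ∘ φ n` on `Lip₀(M)`. -/
def IsRetractionalBasis (p : M) (φ : ℕ → M → M) (e : ℕ → LipFree p) : Prop :=
  ∃ b : SchauderBasis ℝ (LipFree p), (∀ n, b n = e n) ∧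
    ∀ (n : ℕ) (f g : Lip0 p), (∀ y, g y = f (φ n y)) →
      ∀ γ : LipFree p, (b.proj n γ : StrongDual ℝ (Lip0 p)) f =
        (γ : StrongDual ℝ (Lip0 p)) g

end Bases

/-! ### The integer lattice and its retractional bases -/

/-- The integer lattice of dimension `d ≤ ∞` in `c₀`: the null sequences with integer terms
(hence with finitely many nonzero terms) whose terms with index at least `d` vanish. -/
def lattice (d : ℕ∞) : Set C₀(ℕ, ℝ) :=
  {x | (∀ i, ∃ k : ℤ, x i = k) ∧ ∀ i : ℕ, d ≤ i → x i = 0}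

instance (d : ℕ∞) : Zero (lattice d) := ⟨⟨0, fun _ => ⟨0, by simp⟩, fun _ _ => rfl⟩⟩

theorem abs_clamp_le (a b : ℕ) (t : ℝ) : |max (-(a : ℝ)) (min (b : ℝ) t)| ≤ |t| := by
  have ha : (0 : ℝ) ≤ a := a.cast_nonneg
  have hb : (0 : ℝ) ≤ b := b.cast_nonneg
  rw [abs_le]
  refine ⟨?_, max_le (by linarith [abs_nonneg t]) ((min_le_right _ _).trans (le_abs_self t))⟩
  exact le_max_of_le_right (le_min (by linarith [abs_nonneg t]) (neg_abs_le t))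

/-- The retraction of the lattice onto the box `∏ᵢ [-lo i, hi i]`, coordinate by coordinate. -/
def clamp {d : ℕ∞} (lo hi : ℕ → ℕ) (x : lattice d) : lattice d :=
  ⟨{ toFun := fun i => max (-(lo i : ℝ)) (min (hi i : ℝ) (x.1 i))
     continuous_toFun := continuous_of_discreteTopology
     zero_at_infty' := squeeze_zero_norm (fun i => abs_clamp_le (lo i) (hi i) (x.1 i))
       (by simpa using (zero_at_infty x.1).norm) }, by
    refine ⟨fun i => ?_, fun i hi' => ?_⟩
    · obtain ⟨k, hk⟩ := x.2.1 i
      refine ⟨max (-(lo i : ℤ)) (min (hi i : ℤ) k), ?_⟩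
      change max (-(lo i : ℝ)) (min (hi i : ℝ) (x.1 i)) = _
      rw [hk]
      push_cast
      rfl
    · change max (-(lo i : ℝ)) (min (hi i : ℝ) (x.1 i)) = 0
      rw [x.2.2 i hi']
      simp⟩

/-- A way to build up the lattice from the origin point by point, box by box: an increasing
sequence of boxes `∏ᵢ [-lo s i, hi s i]` that starts with `{0}`, exhausts the lattice and moves each
face outwards by at most one layer in a step, and an enumeration `point` of the lattice that lists
each box before the points outside that box (in any order within the layers). -/
structure LatticeGrowth (d : ℕ∞) where
  lo : ℕ → ℕ → ℕ
  hi : ℕ → ℕ → ℕ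
  lo_zero : ∀ i, lo 0 i = 0
  hi_zero : ∀ i, hi 0 i = 0
  lo_step : ∀ s i, lo s i ≤ lo (s + 1) i ∧ lo (s + 1) i ≤ lo s i + 1
  hi_step : ∀ s i, hi s i ≤ hi (s + 1) i ∧ hi (s + 1) i ≤ hi s i + 1
  exhausts : ∀ x : lattice d, ∃ s, clamp (lo s) (hi s) x = x
  point : ℕ → lattice d
  bijective : Function.Bijective point
  order : ∀ s m n, m ≤ n → clamp (lo s) (hi s) (point n) = point n →
    clamp (lo s) (hi s) (point m) = point m

namespace LatticeGrowth

variable {d : ℕ∞} (S : LatticeGrowth d)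

/-- The nearest-point retraction of the lattice onto the `s`-th box. -/
def boxRetraction (s : ℕ) (x : lattice d) : lattice d := clamp (S.lo s) (S.hi s) x

open Classical in
/-- The retraction onto the first `n + 1` points: `x` is sent to the last of the points
`boxRetraction 0 x = 0, boxRetraction 1 x, …` (a sequence that ends with `x`) that is among them.
If `{point 0, …, point n}` lies between the boxes number `s` and `s + 1`, this is
`boxRetraction (s + 1) x` if that point is already listed, and `boxRetraction s x` otherwise. -/
def retraction (n : ℕ) (x : lattice d) : lattice d :=
  S.boxRetraction
    (Nat.findGreatest (fun s => S.boxRetraction s x ∈ S.point '' Set.Iic n)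
      (Nat.find (S.exhausts x))) x

/-- The basis vector `δ(μ) - δ(μ')`, where `μ` is the new point number `n + 1` and `μ'` is its image
under the retraction onto the points before it. -/
def basisVector (n : ℕ) : LipFree (0 : lattice d) :=
  delta 0 (S.point (n + 1)) - delta 0 (S.retraction n (S.point (n + 1)))

end LatticeGrowth

/-- The Hájek–Novotný bases of the Lipschitz-free space of `N`: up to nonzero scalar factors, the
image of a basis of the free space of the `d`-dimensional lattice, built from retractions as above,
under a linear isomorphism of that free space onto the free space of `N`. -/
def IsHajekNovotnyBasis (d : ℕ∞) {N : Type*} [MetricSpace N] (p : N) (e : ℕ → LipFree p) : Prop :=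
  ∃ (S : LatticeGrowth d) (T : LipFree (0 : lattice d) ≃L[ℝ] LipFree p) (c : ℕ → ℝ),
    ∀ n, c n ≠ 0 ∧ e n = c n • T (S.basisVector n)

/-! ### Nets -/

/-- `N` is an `α, β`-net in `M` for some `α, β > 0`: it is `α`-separated and `β`-dense. -/
def IsNet {M : Type*} [MetricSpace M] (N : Set M) : Prop :=
  ∃ α > 0, ∃ β > 0, (∀ x ∈ N, ∀ y ∈ N, x ≠ y → α ≤ dist x y) ∧ ∀ x, Metric.infDist x N ≤ β

/-- The positive cone of `c₀`, as a metric space. -/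
abbrev C0Pos : Type := {x : C₀(ℕ, ℝ) // ∀ i, 0 ≤ x i}

end FreeBasis

end

/-!
A Hájek–Novotný basis is the image of a lattice basis under a linear isomorphism and a scaling, and
both preserve conditionality (`IsConditionalBasis.map`). So everything reduces to the lattices of
dimension at least two, and the nets play no role beyond the existence of the isomorphism.

*The retractions.* The first `n + 1` points lie between two successive boxes, number `s` and
`s + 1`, and the retraction onto them sends `x` to `π_{s+1} x` if that point is listed, to `π_s x`
otherwise (`LatticeGrowth.retraction_eq_ite`). The maps `π_s`, `π_{s+1}` do not increase distances
and are at distance at most `1` from each other, which is at most the distance of distinct lattice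
points; hence the Lipschitz constant `2`. The commutation relations follow from those of the box
retractions.

*The basis.* For retractions `φ n` onto `{μ 0, …, μ n}` of a `1`-separated space, the indicator
function of `{x | φ (n + 1) x = μ (n + 1)}` is Lipschitz, and evaluation at it is the `n`-th
coordinate functional. On `δ_x` the partial sums telescope to `δ (φ n x)`, so the partial sum
operators are adjoint to `f ↦ f ∘ φ n`. They are bounded by the common Lipschitz constant, which
makes the expansions converge on the whole space (`retractionalBasis`).

*Conditionality.* If the basis were unconditional, then for a fixed functional `f` the sums
`∑ |e_n^*(x) f(e_n)|` would be bounded by a multiple of `‖x‖` (`exists_sum_abs_le`). In a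
`1`-separated space every indicator function of a set without the base point is `1`-Lipschitz. Take
the indicator function of the points `(i, 0)` with odd `i`, and `x = δ (k, 0) - δ (k, 1)`, a vector
of norm at most `1`. The coordinates of `δ (k, 0)` at the points `(i, 0)`, `1 ≤ i ≤ k`, are `1`,
those of `δ (k, 1)` vanish for all but a number of `i` that does not depend on `k`, and
`f (e_n) = ±1` there because the retraction of `(i, 0)` is `(i - 1, 0)`
(`LatticeGrowth.retraction_axis`). So the sum is unbounded as `k` grows
(`LatticeGrowth.not_isUnconditionalBasis`).
-/

namespace FreeBasis

/-! ### Schauder bases -/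

section GeneralBases

variable {β : Type*} {X Y : Type*} [NormedAddCommGroup X] [NormedSpace ℝ X]
  [NormedAddCommGroup Y] [NormedSpace ℝ Y]

/-- The image of a generalized Schauder basis under a linear isomorphism, with every vector scaled
by a nonzero factor. -/
noncomputable def mapScale {L : SummationFilter β} (b : GeneralSchauderBasis β ℝ X L)
    (T : X ≃L[ℝ] Y) (c : β → ℝ) (hc : ∀ i, c i ≠ 0) : GeneralSchauderBasis β ℝ Y L where
  basis i := c i • T (b i)
  coord i := (c i)⁻¹ • (b.coord i).comp (T.symm : Y →L[ℝ] X)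
  ortho i j := by
    rcases eq_or_ne i j with rfl | h
    · simp [b.ortho, hc]
    · simp [b.ortho, h]
  expansion y := by
    have h := (b.expansion (T.symm y)).mapL (T : X →L[ℝ] Y)
    simpa [smul_smul, mul_right_comm _ _ (c _), hc] using h

theorem IsConditionalBasis.map {e : ℕ → X} (h : IsConditionalBasis e) (T : X ≃L[ℝ] Y)
    (c : ℕ → ℝ) (hc : ∀ i, c i ≠ 0) : IsConditionalBasis fun n => c n • T (e n) := by
  obtain ⟨⟨b, hb⟩, hu⟩ := h
  refine ⟨⟨mapScale b T c hc, fun n => by simp [mapScale, hb]⟩, fun ⟨b', hb'⟩ => hu ?_⟩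
  refine ⟨mapScale b' T.symm (fun n => (c n)⁻¹) fun n => inv_ne_zero (hc n), fun n => ?_⟩
  simp [mapScale, hb', smul_smul, hc]

/-- A biorthogonal sequence is a Schauder basis if its partial sum operators are uniformly bounded
and the expansions of the elements of a set with dense span are finite. -/
noncomputable def schauderBasisOfBounded (e : ℕ → X) (c : ℕ → StrongDual ℝ X)
    (ortho : ∀ i j, c i (e j) = (Pi.single j (1 : ℝ) : ℕ → ℝ) i) {D : Set X}
    (hD : Dense (Submodule.span ℝ D : Set X))
    (hK : ∃ K : ℝ, ∀ n x, ‖∑ i ∈ Finset.range n, c i x • e i‖ ≤ K * ‖x‖)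
    (hfin : ∀ x ∈ D, ∀ᶠ n in Filter.atTop, ∑ i ∈ Finset.range n, c i x • e i = x) :
    SchauderBasis ℝ X where
  basis := e
  coord := c
  ortho i j := by rw [ortho]; congr
  expansion x := by
    rw [HasSum, SummationFilter.conditional_filter_eq_map_range, Filter.tendsto_map'_iff]
    obtain ⟨K, hK⟩ := hK
    have heq : Equicontinuous fun n y => ∑ i ∈ Finset.range n, c i y • e i := by
      refine (LipschitzWith.uniformEquicontinuous _ K.toNNReal fun n => ?_).equicontinuous
      refine LipschitzWith.of_dist_le_mul fun y z => ?_
      rw [dist_eq_norm, dist_eq_norm, ← Finset.sum_sub_distrib]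
      simp_rw [← sub_smul, ← map_sub]
      exact (hK n _).trans
        (mul_le_mul_of_nonneg_right (Real.le_coe_toNNReal K) (norm_nonneg _))
    refine (heq.isClosed_setOfPred_tendsto continuous_id).closure_subset_iff.2 ?_ (hD x)
    intro y hy
    change Filter.Tendsto (fun n => ∑ i ∈ Finset.range n, c i y • e i) Filter.atTop (nhds y)
    induction hy using Submodule.span_induction with
    | mem y hy => exact tendsto_const_nhds.congr' ((hfin y hy).mono fun n h => h.symm)
    | zero => simp
    | add y z _ _ hy hz => simpa [add_smul, Finset.sum_add_distrib] using hy.add hz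
    | smul a y _ hy => simpa [mul_smul, Finset.smul_sum] using hy.const_smul a

/-- The coordinate functionals depend on the basis vectors alone, not on the mode of convergence. -/
theorem coord_eq_of_basis_eq {L L' : SummationFilter β} [L'.NeBot] [L'.LeAtTop]
    (b : GeneralSchauderBasis β ℝ X L) (b' : GeneralSchauderBasis β ℝ X L')
    (h : ∀ i, b i = b' i) (i : β) : b.coord i = b'.coord i := by
  classical
  ext x
  have h1 := (b'.expansion x).mapL (b.coord i)
  have h2 : HasSum (fun j => b.coord i (b'.coord j x • b' j)) (b'.coord i x) L' := by
    convert hasSum_ite_eq (L := L') i (b'.coord i x) using 2 with j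
    rw [← h, map_smul, b.ortho]
    rcases eq_or_ne j i with rfl | hj
    · simp
    · simp [hj, hj.symm]
  exact h1.unique h2

/-- Under a functional, the expansions in an unconditional basis converge absolutely, with a bound
that is uniform on the unit ball. -/
theorem exists_sum_abs_le [CompleteSpace X] (b : UnconditionalSchauderBasis β ℝ X)
    (f : StrongDual ℝ X) :
    ∃ C : ℝ, ∀ (A : Finset β) (x : X), ∑ i ∈ A, |b.coord i x * f (b i)| ≤ C * ‖x‖ := by
  classical
  obtain ⟨C, hC⟩ := b.exists_norm_proj_le
  refine ⟨2 * (‖f‖ * C), fun A x => ?_⟩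
  have key : ∀ B : Finset β, |∑ i ∈ B, b.coord i x * f (b i)| ≤ ‖f‖ * C * ‖x‖ := fun B => by
    have h : ∑ i ∈ B, b.coord i x * f (b i) = f (b.proj B x) := by simp
    rw [h, ← Real.norm_eq_abs, mul_assoc]
    exact (f.le_opNorm _).trans (mul_le_mul_of_nonneg_left
      ((b.proj B).le_of_opNorm_le (hC B) x) (norm_nonneg f))
  rw [← Finset.sum_filter_add_sum_filter_not A fun i => 0 ≤ b.coord i x * f (b i),
    Finset.sum_congr rfl fun i hi => abs_of_nonneg (Finset.mem_filter.1 hi).2,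
    Finset.sum_congr (g := fun i => -(b.coord i x * f (b i))) rfl fun i hi =>
      abs_of_neg (not_le.1 (Finset.mem_filter.1 hi).2), Finset.sum_neg_distrib]
  linarith [le_abs_self _ |>.trans (key (A.filter fun i => 0 ≤ b.coord i x * f (b i))),
    neg_le_abs _ |>.trans (key (A.filter fun i => ¬ 0 ≤ b.coord i x * f (b i)))]

end GeneralBases

/-! ### Lipschitz-free spaces -/

section LipFree

variable {M : Type*} [MetricSpace M] {p : M}

/-- The composition `f ∘ φ` as an element of `Lip₀(M)`. -/
def Lip0.comp (f : Lip0 p) {φ : M → M} {K : NNReal} (hφ : LipschitzWith K φ) (hp : φ p = p) :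
    Lip0 p :=
  (⟨fun x => f (φ x), ⟨_, f.lipschitz.choose_spec.comp hφ⟩, by simp [hp]⟩ : ↥(lip0Submodule p))

theorem Lip0.norm_comp_le (f : Lip0 p) {φ : M → M} {K : NNReal} (hφ : LipschitzWith K φ)
    (hp : φ p = p) : ‖f.comp hφ hp‖ ≤ K * ‖f‖ := by
  refine Lip0.norm_le _ (mul_nonneg K.2 f.norm_nonneg') fun x y => ?_
  refine (f.abs_sub_le (φ x) (φ y)).trans ?_
  rw [mul_comm (K : ℝ), mul_assoc]
  exact mul_le_mul_of_nonneg_left (hφ.dist_le_mul x y) f.norm_nonneg'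

open Classical in
/-- In a `1`-separated space the indicator function of every set that misses the base point is in
`Lip₀(M)`. -/
noncomputable def Lip0.indicator (hsep : Pairwise fun x y : M => 1 ≤ dist x y) (s : Set M)
    (hp : p ∉ s) : Lip0 p :=
  (⟨fun x => if x ∈ s then 1 else 0, ⟨1, LipschitzWith.of_dist_le_mul fun x y => by
    rcases eq_or_ne x y with rfl | h
    · simp
    · refine le_trans ?_ (by simpa using hsep h)
      split_ifs <;> simp⟩, by simp [hp]⟩ : ↥(lip0Submodule p))

open Classical in
@[simp] theorem Lip0.indicator_apply (hsep : Pairwise fun x y : M => 1 ≤ dist x y) (s : Set M)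
    (hp : p ∉ s) (x : M) : Lip0.indicator hsep s hp x = if x ∈ s then 1 else 0 := rfl

/-- The topology of the Lipschitz-free space is found through its norm. The instance that comes from
the subtype agrees with it only after unfolding `Lip0`, which instance unification does not do. -/
noncomputable instance : TopologicalSpace (LipFree p) := UniformSpace.toTopologicalSpace

instance : CompleteSpace (LipFree p) :=
  (Submodule.isClosed_topologicalClosure _).completeSpace_coe

theorem norm_delta_sub_le (x y : M) : ‖delta p x - delta p y‖ ≤ dist x y := by
  refine ContinuousLinearMap.opNorm_le_bound _ dist_nonneg fun f => ?_
  rw [mul_comm]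
  exact f.abs_sub_le x y

theorem dense_span_delta : Dense (Submodule.span ℝ (Set.range (delta p)) : Set (LipFree p)) := by
  rw [Subtype.dense_iff]
  intro γ hγ
  have h : ((↑) : LipFree p → StrongDual ℝ (Lip0 p)) '' Submodule.span ℝ (Set.range (delta p)) =
      Submodule.span ℝ (Set.range (dirac p)) := by
    have := Submodule.map_span (lipFreeSubmodule p).subtype (Set.range (delta p))
    rw [← Set.range_comp] at this
    exact congrArg
      (fun S : Submodule ℝ (StrongDual ℝ (Lip0 p)) => (S : Set (StrongDual ℝ (Lip0 p)))) this
  exact closure_mono h.ge hγ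

/-- Evaluation of the elements of the Lipschitz-free space at a function in `Lip₀(M)`. -/
noncomputable def evalAt (f : Lip0 p) : StrongDual ℝ (LipFree p) :=
  LinearMap.mkContinuous
    { toFun := fun γ : LipFree p => (γ : StrongDual ℝ (Lip0 p)) f
      map_add' := fun _ _ => rfl
      map_smul' := fun _ _ => rfl }
    ‖f‖ fun γ => ((γ : StrongDual ℝ (Lip0 p)).le_opNorm f).trans_eq (mul_comm _ _)

theorem evalAt_delta (f : Lip0 p) (x : M) : evalAt f (delta p x) = f x := rfl

theorem evalAt_delta_sub (f : Lip0 p) (x y : M) :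
    evalAt f (delta p x - delta p y) = f x - f y := rfl

theorem abs_evalAt_le (f : Lip0 p) (γ : LipFree p) : |evalAt f γ| ≤ ‖γ‖ * ‖f‖ :=
  (γ : StrongDual ℝ (Lip0 p)).le_opNorm f

theorem ext_evalAt {γ γ' : LipFree p} (h : ∀ f : Lip0 p, evalAt f γ = evalAt f γ') : γ = γ' :=
  Subtype.ext (ContinuousLinearMap.ext h)

theorem norm_le_of_evalAt {γ : LipFree p} {C : ℝ} (hC : 0 ≤ C)
    (h : ∀ f : Lip0 p, |evalAt f γ| ≤ C * ‖f‖) : ‖γ‖ ≤ C :=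
  ContinuousLinearMap.opNorm_le_bound (γ : StrongDual ℝ (Lip0 p)) hC h

end LipFree

/-! ### The basis of a retraction system -/

section Retractional

variable {M : Type*} [MetricSpace M] {p : M} {μ : ℕ → M} {φ : ℕ → M → M}

namespace IsRetractionSystem

variable (h : IsRetractionSystem p μ φ)
include h

theorem mem (n : ℕ) (x : M) : φ n x ∈ μ '' Set.Iic n := h.range_eq n ▸ Set.mem_range_self x

theorem apply_point {k n : ℕ} (hk : k ≤ n) : φ n (μ k) = μ k := by
  obtain ⟨y, hy⟩ : μ k ∈ Set.range (φ n) := by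
    rw [h.range_eq]; exact ⟨k, hk, rfl⟩
  rw [← hy]
  exact congrFun (h.comp n n le_rfl).1 y

theorem apply_base (n : ℕ) : φ n p = p := h.zero ▸ h.apply_point n.zero_le

theorem apply_zero (x : M) : φ 0 x = p := by
  obtain ⟨k, hk, hx⟩ := h.mem 0 x
  rw [← hx, Nat.le_zero.1 hk, h.zero]

theorem apply_apply {m n : ℕ} (hmn : n ≤ m) (x : M) : φ n (φ m x) = φ n x :=
  congrFun (h.comp m n hmn).2 x

theorem apply_eq_self {n : ℕ} {x : M} (hx : x ∈ μ '' Set.Iic n) : φ n x = x := by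
  obtain ⟨k, hk, rfl⟩ := hx
  exact h.apply_point hk

theorem apply_ne_point {k n : ℕ} (hk : n < k) (x : M) : φ n x ≠ μ k := fun hx => by
  obtain ⟨j, hj, hjx⟩ := h.mem n x
  have := h.injective (hjx.trans hx)
  exact absurd (Set.mem_Iic.1 hj) (by omega)

theorem eq_of_apply_ne_point {n : ℕ} {x : M} (hx : φ (n + 1) x ≠ μ (n + 1)) :
    φ (n + 1) x = φ n x := by
  obtain ⟨j, hj, hjx⟩ := h.mem (n + 1) x
  have hj' : j ≠ n + 1 := fun e => hx (by rw [← hjx, e])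
  rw [← h.apply_apply n.le_succ x, ← hjx, h.apply_point]
  have := Set.mem_Iic.1 hj
  omega

theorem surjective (hsep : Pairwise fun x y : M => 1 ≤ dist x y) : Function.Surjective μ :=
  fun x => by
    obtain ⟨n, hn⟩ := h.dense.exists_dist_lt x one_pos
    exact ⟨n, by_contra fun hne => absurd (hsep (Ne.symm hne)) (not_le.2 hn)⟩

end IsRetractionSystem

variable (hsep : Pairwise fun x y : M => 1 ≤ dist x y) (h : IsRetractionSystem p μ φ)

/-- The function on `M` that represents the `n`-th coordinate functional: the indicator function of
the points that the retraction number `n + 1` sends to the new point `μ (n + 1)`. -/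
noncomputable def coordFun (n : ℕ) : Lip0 p :=
  Lip0.indicator hsep {x | φ (n + 1) x = μ (n + 1)} fun hp =>
    Nat.succ_ne_zero n <| h.injective <| hp.symm.trans <| (h.apply_base _).trans h.zero.symm

open Classical in
theorem coordFun_apply (n : ℕ) (x : M) :
    coordFun hsep h n x = if φ (n + 1) x = μ (n + 1) then 1 else 0 := rfl

/-- Either `x` is sent to the same point by the retractions number `n` and `n + 1`, or the latter
sends it to the new point. -/
theorem coordFun_mul_sub (f : M → ℝ) (n : ℕ) (x : M) :
    coordFun hsep h n x * (f (μ (n + 1)) - f (φ n (μ (n + 1)))) =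
      f (φ (n + 1) x) - f (φ n x) := by
  rw [coordFun_apply]
  split_ifs with hx
  · rw [← h.apply_apply n.le_succ x, hx, one_mul]
  · rw [h.eq_of_apply_ne_point hx, sub_self, zero_mul]

/-- In the `δ_x` the expansion telescopes. -/
theorem sum_coordFun_mul_sub (f : Lip0 p) (n : ℕ) (x : M) :
    ∑ i ∈ Finset.range n, coordFun hsep h i x * (f (μ (i + 1)) - f (φ i (μ (i + 1)))) =
      f (φ n x) := by
  rw [Finset.sum_congr rfl fun i _ => coordFun_mul_sub hsep h f i x,
    Finset.sum_range_sub fun i => f (φ i x), h.apply_zero, f.map_base, sub_zero]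

variable {e : ℕ → LipFree p} (he : ∀ n, e n = delta p (μ (n + 1)) - delta p (φ n (μ (n + 1))))
include he

theorem evalAt_vector (f : Lip0 p) (n : ℕ) :
    evalAt f (e n) = f (μ (n + 1)) - f (φ n (μ (n + 1))) := by
  rw [he, evalAt_delta_sub]

/-- The `n`-th partial sum operator of the expansion is adjoint to `f ↦ f ∘ φ n`. -/
theorem sum_coordFun_mul_evalAt (n : ℕ) (f g : Lip0 p) (hg : ∀ y, g y = f (φ n y))
    (γ : LipFree p) :
    ∑ i ∈ Finset.range n, evalAt (coordFun hsep h i) γ * evalAt f (e i) = evalAt g γ := by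
  have key : ∑ i ∈ Finset.range n, evalAt f (e i) • evalAt (coordFun hsep h i) = evalAt g := by
    refine ContinuousLinearMap.ext_on dense_span_delta ?_
    rintro _ ⟨x, rfl⟩
    rw [evalAt_delta, hg, ← sum_coordFun_mul_sub hsep h f n x]
    simp [evalAt_vector he, evalAt_delta, mul_comm]
  rw [← key]
  simp [mul_comm]

/-- The partial sum operators are bounded by the common Lipschitz constant of the retractions. -/
theorem exists_norm_sum_le : ∃ K : ℝ, ∀ n γ,
    ‖∑ i ∈ Finset.range n, evalAt (coordFun hsep h i) γ • e i‖ ≤ K * ‖γ‖ := by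
  obtain ⟨K, hK⟩ := h.lipschitz
  refine ⟨K, fun n γ => norm_le_of_evalAt
    (mul_nonneg K.2 (norm_nonneg (γ : StrongDual ℝ (Lip0 p)))) fun f => ?_⟩
  have hfg := sum_coordFun_mul_evalAt hsep h he n f (f.comp (hK n) (h.apply_base n))
    (fun _ => rfl) γ
  simp only [map_sum, map_smul, smul_eq_mul]
  rw [hfg]
  refine (abs_evalAt_le _ γ).trans ?_
  rw [mul_comm (K : ℝ), mul_assoc]
  exact mul_le_mul_of_nonneg_left (f.norm_comp_le _ _)
    (norm_nonneg (γ : StrongDual ℝ (Lip0 p)))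

/-- The Schauder basis that a retraction system on a `1`-separated space gives rise to. -/
noncomputable def retractionalBasis : SchauderBasis ℝ (LipFree p) :=
  schauderBasisOfBounded e (fun n => evalAt (coordFun hsep h n))
    (fun i j => by
      rw [evalAt_vector he, coordFun_apply, coordFun_apply]
      rcases lt_trichotomy i j with hij | rfl | hij
      · rw [h.apply_apply hij, sub_self, Pi.single_eq_of_ne hij.ne]
      · rw [h.apply_point le_rfl, if_pos rfl,
          h.apply_eq_self (Set.image_mono (Set.Iic_subset_Iic.2 i.le_succ) (h.mem i _)),
          if_neg (h.apply_ne_point (Nat.lt_succ_self i) _), sub_zero, Pi.single_eq_same]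
      · rw [h.apply_point (by omega), if_neg (fun e => by have := h.injective e; omega),
          h.apply_eq_self (Set.image_mono (Set.Iic_subset_Iic.2 (by omega)) (h.mem j _)),
          if_neg (h.apply_ne_point (by omega) _), sub_zero, Pi.single_eq_of_ne hij.ne'])
    dense_span_delta (exists_norm_sum_le hsep h he) fun γ hγ => by
      obtain ⟨x, rfl⟩ := hγ
      obtain ⟨k, rfl⟩ := h.surjective hsep x
      refine Filter.eventually_atTop.2 ⟨k, fun n hn => ext_evalAt fun f => ?_⟩
      simp only [map_sum, map_smul, smul_eq_mul, evalAt_vector he, evalAt_delta]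
      rw [sum_coordFun_mul_sub, h.apply_point hn]

include hsep h

theorem isRetractionalBasis_of_separated : IsRetractionalBasis p φ e := by
  refine ⟨retractionalBasis hsep h he, fun _ => rfl, fun n f g hg γ => ?_⟩
  change evalAt f _ = evalAt g γ
  rw [← sum_coordFun_mul_evalAt hsep h he n f g hg γ, SchauderBasis.proj_apply, map_sum]
  simp only [map_smul, smul_eq_mul]
  rfl

/-- A retractional basis of a `1`-separated space is not unconditional if, for a fixed
function `f`, there are pairs of points at bounded distance such that the numbers of basis vectors
which occur in the expansion of only the first one and on which `f` is `±1` are unbounded. -/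
theorem not_isUnconditionalBasis_of_separated (f : Lip0 p) (r : ℝ)
    (H : ∀ N : ℕ, ∃ x y : M, dist x y ≤ r ∧ ∃ A : Finset ℕ, N ≤ A.card ∧ ∀ n ∈ A,
      |f (μ (n + 1)) - f (φ n (μ (n + 1)))| = 1 ∧ φ (n + 1) x = μ (n + 1) ∧
        φ (n + 1) y ≠ μ (n + 1)) : ¬ IsUnconditionalBasis e := by
  rintro ⟨b, hb⟩
  obtain ⟨C, hC⟩ := exists_sum_abs_le b (evalAt f)
  obtain ⟨N, hN⟩ := exists_nat_gt (|C| * r)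
  obtain ⟨x, y, hxy, A, hA, hAn⟩ := H N
  have h1 := hC A (delta p x - delta p y)
  have h2 : ∀ n ∈ A, |b.coord n (delta p x - delta p y) * evalAt f (b n)| = 1 := fun n hn => by
    obtain ⟨hf, hx, hy⟩ := hAn n hn
    rw [coord_eq_of_basis_eq b (retractionalBasis hsep h he) hb n]
    change |evalAt (coordFun hsep h n) _ * _| = 1
    rw [evalAt_delta_sub, coordFun_apply, coordFun_apply, if_pos hx, if_neg hy,
      hb, evalAt_vector he, sub_zero, one_mul, hf]
  rw [Finset.sum_congr rfl h2, Finset.sum_const, nsmul_eq_mul, mul_one] at h1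
  have h3 : C * ‖delta p x - delta p y‖ ≤ |C| * r :=
    mul_le_mul (le_abs_self C) ((norm_delta_sub_le x y).trans hxy)
      (norm_nonneg (dirac p x - dirac p y)) (abs_nonneg C)
  have h4 : (N : ℝ) ≤ A.card := by exact_mod_cast hA
  linarith

end Retractional

/-! ### The integer lattice -/

section Lattice

variable {d : ℕ∞}

theorem lattice_ext {x y : lattice d} (h : ∀ i, x.1 i = y.1 i) : x = y :=
  Subtype.ext (DFunLike.ext _ _ h)

theorem abs_sub_le_dist (x y : lattice d) (i : ℕ) : |x.1 i - y.1 i| ≤ dist x y := by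
  have := BoundedContinuousFunction.dist_coe_le_dist (f := x.1.toBCF) (g := y.1.toBCF) i
  exact this

theorem dist_le_of_forall {x y : lattice d} {C : ℝ} (hC : 0 ≤ C)
    (h : ∀ i, |x.1 i - y.1 i| ≤ C) : dist x y ≤ C :=
  (BoundedContinuousFunction.dist_le (f := x.1.toBCF) (g := y.1.toBCF) hC).2 h

theorem lattice_separated : Pairwise fun x y : lattice d => 1 ≤ dist x y := fun x y hxy => by
  obtain ⟨i, hi⟩ : ∃ i, x.1 i ≠ y.1 i := by
    by_contra! h
    exact hxy (lattice_ext h)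
  refine le_trans ?_ (abs_sub_le_dist x y i)
  obtain ⟨k, hk⟩ := x.2.1 i
  obtain ⟨l, hl⟩ := y.2.1 i
  rw [hk, hl] at hi ⊢
  have hkl : k - l ≠ 0 := sub_ne_zero.2 fun h => hi (by rw [h])
  exact_mod_cast Int.one_le_abs hkl

theorem clamp_apply (lo hi : ℕ → ℕ) (x : lattice d) (i : ℕ) :
    (clamp lo hi x).1 i = max (-(lo i : ℝ)) (min (hi i : ℝ) (x.1 i)) := rfl

theorem clamp_clamp_of_le {lo hi lo' hi' : ℕ → ℕ} (hlo : ∀ i, lo i ≤ lo' i)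
    (hhi : ∀ i, hi i ≤ hi' i) (x : lattice d) :
    clamp lo hi (clamp lo' hi' x) = clamp lo hi x := by
  refine lattice_ext fun i => ?_
  simp only [clamp_apply]
  have h1 : (lo i : ℝ) ≤ lo' i := by exact_mod_cast hlo i
  have h2 : (hi i : ℝ) ≤ hi' i := by exact_mod_cast hhi i
  have h3 : (0 : ℝ) ≤ lo i := Nat.cast_nonneg _
  have h4 : (0 : ℝ) ≤ hi i := Nat.cast_nonneg _
  grind

theorem clamp_clamp_of_ge {lo hi lo' hi' : ℕ → ℕ} (hlo : ∀ i, lo i ≤ lo' i)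
    (hhi : ∀ i, hi i ≤ hi' i) (x : lattice d) :
    clamp lo' hi' (clamp lo hi x) = clamp lo hi x := by
  refine lattice_ext fun i => ?_
  simp only [clamp_apply]
  have h1 : (lo i : ℝ) ≤ lo' i := by exact_mod_cast hlo i
  have h2 : (hi i : ℝ) ≤ hi' i := by exact_mod_cast hhi i
  have h3 : (0 : ℝ) ≤ lo i := Nat.cast_nonneg _
  have h4 : (0 : ℝ) ≤ hi i := Nat.cast_nonneg _
  grind

theorem dist_clamp_le (lo hi : ℕ → ℕ) (x y : lattice d) :
    dist (clamp lo hi x) (clamp lo hi y) ≤ dist x y := by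
  refine dist_le_of_forall dist_nonneg fun i => le_trans ?_ (abs_sub_le_dist x y i)
  rw [clamp_apply, clamp_apply]
  refine (abs_max_sub_max_le_max _ _ _ _).trans (max_le (by simp) ?_)
  exact (abs_min_sub_min_le_max _ _ _ _).trans (max_le (by simp) le_rfl)

theorem dist_clamp_clamp_le {lo hi lo' hi' : ℕ → ℕ} (hlo : ∀ i, lo i ≤ lo' i ∧ lo' i ≤ lo i + 1)
    (hhi : ∀ i, hi i ≤ hi' i ∧ hi' i ≤ hi i + 1) (x : lattice d) :
    dist (clamp lo hi x) (clamp lo' hi' x) ≤ 1 := by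
  refine dist_le_of_forall zero_le_one fun i => ?_
  have h1 : (lo i : ℝ) ≤ lo' i := by exact_mod_cast (hlo i).1
  have h2 : (hi i : ℝ) ≤ hi' i := by exact_mod_cast (hhi i).1
  have h3 : (lo' i : ℝ) ≤ lo i + 1 := by exact_mod_cast (hlo i).2
  have h4 : (hi' i : ℝ) ≤ hi i + 1 := by exact_mod_cast (hhi i).2
  rw [clamp_apply, clamp_apply]
  refine (abs_max_sub_max_le_max _ _ _ _).trans (max_le ?_ ?_)
  · rw [abs_le]; constructor <;> linarith
  · refine (abs_min_sub_min_le_max _ _ _ _).trans (max_le ?_ (by simp))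
    rw [abs_le]; constructor <;> linarith

end Lattice

/-! ### The retractions of a lattice growth -/

namespace LatticeGrowth

variable {d : ℕ∞} (S : LatticeGrowth d)

theorem lo_mono (i : ℕ) : Monotone fun s => S.lo s i :=
  monotone_nat_of_le_succ fun s => (S.lo_step s i).1

theorem hi_mono (i : ℕ) : Monotone fun s => S.hi s i :=
  monotone_nat_of_le_succ fun s => (S.hi_step s i).1

theorem boxRetraction_boxRetraction_of_le {s t : ℕ} (h : s ≤ t) (x : lattice d) :
    S.boxRetraction s (S.boxRetraction t x) = S.boxRetraction s x :=
  clamp_clamp_of_le (fun i => S.lo_mono i h) (fun i => S.hi_mono i h) x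

theorem boxRetraction_boxRetraction_of_ge {s t : ℕ} (h : s ≤ t) (x : lattice d) :
    S.boxRetraction t (S.boxRetraction s x) = S.boxRetraction s x :=
  clamp_clamp_of_ge (fun i => S.lo_mono i h) (fun i => S.hi_mono i h) x

/-- The boxes increase. -/
theorem boxRetraction_eq_self_of_le {s t : ℕ} (h : s ≤ t) {x : lattice d}
    (hx : S.boxRetraction s x = x) : S.boxRetraction t x = x := by
  rw [← hx, S.boxRetraction_boxRetraction_of_ge h]

theorem boxRetraction_zero (x : lattice d) : S.boxRetraction 0 x = 0 :=
  lattice_ext fun i => by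
    rw [boxRetraction, clamp_apply, S.lo_zero, S.hi_zero]
    change _ = (0 : ℝ)
    rcases le_total (x.1 i) 0 with h | h <;> simp [h]

theorem boxRetraction_point_of_le {s m n : ℕ} (hmn : m ≤ n)
    (h : S.boxRetraction s (S.point n) = S.point n) :
    S.boxRetraction s (S.point m) = S.point m := S.order s m n hmn h

theorem point_zero : S.point 0 = 0 := by
  obtain ⟨n, hn⟩ := S.bijective.2 0
  have h := S.boxRetraction_point_of_le (s := 0) n.zero_le (by rw [boxRetraction_zero, hn])
  rw [← h, boxRetraction_zero]

theorem zero_mem (n : ℕ) : 0 ∈ S.point '' Set.Iic n := ⟨0, n.zero_le, S.point_zero⟩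

/-- The first points up to a point of a box lie in that box. -/
theorem boxRetraction_eq_self_of_mem {s n : ℕ} (h : S.boxRetraction s (S.point n) = S.point n)
    {x : lattice d} (hx : x ∈ S.point '' Set.Iic n) : S.boxRetraction s x = x := by
  obtain ⟨m, hm, rfl⟩ := hx
  exact S.boxRetraction_point_of_le hm h

/-- The points of a box that does not contain the point number `n` are listed before it. -/
theorem mem_of_boxRetraction_eq_self {s n : ℕ} (h : S.boxRetraction s (S.point n) ≠ S.point n)
    {x : lattice d} (hx : S.boxRetraction s x = x) : x ∈ S.point '' Set.Iic n := by
  obtain ⟨m, rfl⟩ := S.bijective.2 x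
  exact ⟨m, not_lt.1 fun hnm => h (S.boxRetraction_point_of_le hnm.le hx), rfl⟩

/-- The value of the retraction onto the first points is the furthest point on the path
`s ↦ boxRetraction s x` that is among them. -/
theorem retraction_spec (n : ℕ) (x : lattice d) :
    (∃ t, S.retraction n x = S.boxRetraction t x) ∧ S.retraction n x ∈ S.point '' Set.Iic n ∧
      ∀ t, S.boxRetraction t x ∈ S.point '' Set.Iic n →
        S.boxRetraction t (S.retraction n x) = S.boxRetraction t x := by
  classical
  refine ⟨⟨_, rfl⟩, ?_, fun t ht => ?_⟩
  · exact Nat.findGreatest_spec (P := fun s => S.boxRetraction s x ∈ S.point '' Set.Iic n)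
      (Nat.zero_le _) (by rw [boxRetraction_zero]; exact S.zero_mem n)
  · rcases le_total t (Nat.find (S.exhausts x)) with h | h
    · refine S.boxRetraction_boxRetraction_of_le (Nat.le_findGreatest h ht) x
    · have hfind : S.boxRetraction (Nat.find (S.exhausts x)) x = x := Nat.find_spec (S.exhausts x)
      have hx : S.boxRetraction t x = x := S.boxRetraction_eq_self_of_le h hfind
      rw [hx] at ht
      have : S.retraction n x = x := by
        conv_rhs => rw [← hfind]
        rw [retraction,
          Nat.findGreatest_eq (P := fun s => S.boxRetraction s x ∈ S.point '' Set.Iic n)]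
        rw [hfind]
        exact ht
      rw [this]

theorem retraction_mem (n : ℕ) (x : lattice d) : S.retraction n x ∈ S.point '' Set.Iic n :=
  (S.retraction_spec n x).2.1

theorem retraction_eq_self {n : ℕ} {x : lattice d} (hx : x ∈ S.point '' Set.Iic n) :
    S.retraction n x = x := by
  obtain ⟨t, ht⟩ := S.exhausts x
  have ht : S.boxRetraction t x = x := ht
  obtain ⟨⟨u, hu⟩, -, h⟩ := S.retraction_spec n x
  have h1 := h (max t u) (by rwa [S.boxRetraction_eq_self_of_le (le_max_left t u) ht])
  rwa [hu, S.boxRetraction_boxRetraction_of_ge (le_max_right t u),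
    S.boxRetraction_eq_self_of_le (le_max_left t u) ht, ← hu] at h1

theorem exists_level (n : ℕ) : ∃ s, S.boxRetraction (s + 1) (S.point n) = S.point n := by
  obtain ⟨s, hs⟩ := S.exhausts (S.point n)
  exact ⟨s, S.boxRetraction_eq_self_of_le s.le_succ hs⟩

open Classical in
/-- The number `s` such that the first `n + 1` points lie between the boxes number `s` and
`s + 1`. -/
noncomputable def level (n : ℕ) : ℕ := Nat.find (S.exists_level n)

theorem boxRetraction_level_succ (n : ℕ) :
    S.boxRetraction (S.level n + 1) (S.point n) = S.point n := by
  classical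
  exact Nat.find_spec (S.exists_level n)

theorem level_mono {m n : ℕ} (h : n ≤ m) : S.level n ≤ S.level m := by
  classical
  exact Nat.find_min' (S.exists_level n)
    (S.boxRetraction_point_of_le h (S.boxRetraction_level_succ m))

theorem boxRetraction_level_mem (n : ℕ) (x : lattice d) :
    S.boxRetraction (S.level n) x ∈ S.point '' Set.Iic n := by
  classical
  rcases hs : S.level n with _ | s
  · rw [boxRetraction_zero]
    exact S.zero_mem n
  · refine S.mem_of_boxRetraction_eq_self (s := s + 1) (fun h => ?_)
      (S.boxRetraction_boxRetraction_of_le le_rfl x)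
    have := Nat.find_min' (S.exists_level n) h
    have h' : S.level n ≤ s := this
    omega

open Classical in
theorem retraction_eq_ite (n : ℕ) (x : lattice d) :
    S.retraction n x = if S.boxRetraction (S.level n + 1) x ∈ S.point '' Set.Iic n then
      S.boxRetraction (S.level n + 1) x else S.boxRetraction (S.level n) x := by
  obtain ⟨⟨t, ht⟩, hmem, h⟩ := S.retraction_spec n x
  have hbox := S.boxRetraction_eq_self_of_mem (S.boxRetraction_level_succ n) hmem
  split_ifs with hx
  · rw [← h _ hx, hbox]
  · rw [← h _ (S.boxRetraction_level_mem n x)]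
    have hts : t ≤ S.level n := by
      by_contra! hlt
      rw [ht, S.boxRetraction_boxRetraction_of_le hlt, ← ht] at hbox
      exact hx (hbox ▸ hmem)
    rw [ht, S.boxRetraction_boxRetraction_of_ge hts]

/-- The first `n + 1` points lie between two successive boxes, the retractions onto which are at
distance at most `1`; this is at most the distance of two distinct points of the lattice. -/
theorem lipschitzWith_retraction (n : ℕ) : LipschitzWith 2 (S.retraction n) := by
  classical
  refine LipschitzWith.of_dist_le_mul fun x y => ?_
  rcases eq_or_ne x y with rfl | hxy
  · simp
  have h1 : 1 ≤ dist x y := lattice_separated hxy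
  have hs : ∀ s, dist (S.boxRetraction s x) (S.boxRetraction s y) ≤ dist x y :=
    fun s => dist_clamp_le _ _ x y
  have hstep : ∀ s z, dist (S.boxRetraction s z) (S.boxRetraction (s + 1) z) ≤ 1 :=
    fun s z => dist_clamp_clamp_le (S.lo_step s) (S.hi_step s) z
  set s := S.level n
  rw [S.retraction_eq_ite n x, S.retraction_eq_ite n y, NNReal.coe_ofNat]
  split_ifs
  · linarith [hs (s + 1)]
  · linarith [hs (s + 1), hstep s y, dist_comm (S.boxRetraction s y) (S.boxRetraction (s + 1) y),
      dist_triangle (S.boxRetraction (s + 1) x) (S.boxRetraction (s + 1) y) (S.boxRetraction s y)]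
  · linarith [hs (s + 1), hstep s x,
      dist_triangle (S.boxRetraction s x) (S.boxRetraction (s + 1) x) (S.boxRetraction (s + 1) y)]
  · linarith [hs s]

theorem retraction_retraction {m n : ℕ} (hnm : n ≤ m) (x : lattice d) :
    S.retraction n (S.retraction m x) = S.retraction n x := by
  classical
  have key : ∀ t, S.level n + 1 ≤ t →
      S.retraction n (S.boxRetraction t x) = S.retraction n x := fun t ht => by
    rw [S.retraction_eq_ite n x, S.retraction_eq_ite n (S.boxRetraction t x),
      S.boxRetraction_boxRetraction_of_le ht,
      S.boxRetraction_boxRetraction_of_le ((Nat.le_succ _).trans ht)]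
  have hl := S.level_mono hnm
  rw [S.retraction_eq_ite m x]
  split_ifs with hx
  · exact key _ (by omega)
  · rcases hl.lt_or_eq with hlt | heq
    · exact key _ hlt
    · rw [← heq] at hx ⊢
      rw [S.retraction_eq_self (S.boxRetraction_level_mem n x), S.retraction_eq_ite n x, if_neg]
      exact fun h => hx (Set.image_mono (Set.Iic_subset_Iic.2 hnm) h)

theorem isRetractionSystem : IsRetractionSystem 0 S.point S.retraction where
  injective := S.bijective.1
  zero := S.point_zero
  range_eq n := Set.Subset.antisymm (Set.range_subset_iff.2 (S.retraction_mem n))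
    fun x hx => ⟨x, S.retraction_eq_self hx⟩
  dense := S.bijective.2.denseRange
  lipschitz := ⟨2, S.lipschitzWith_retraction⟩
  comp _ n hnm := ⟨funext fun x => S.retraction_eq_self
      (Set.image_mono (Set.Iic_subset_Iic.2 hnm) (S.retraction_mem n x)),
    funext (S.retraction_retraction hnm)⟩

/-- The points on the path `s ↦ boxRetraction s x` are values of the retractions. -/
theorem retraction_eq_point {n t : ℕ} {x : lattice d} (h : S.boxRetraction t x = S.point n) :
    S.retraction n x = S.point n := by
  obtain ⟨-, hmem, hspec⟩ := S.retraction_spec n x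
  have hn : S.boxRetraction t (S.point n) = S.point n := by
    rw [← h, S.boxRetraction_boxRetraction_of_le le_rfl]
  rw [← S.boxRetraction_eq_self_of_mem hn hmem, hspec t (h ▸ ⟨n, Set.self_mem_Iic, rfl⟩), h]

theorem isRetractionalBasis : IsRetractionalBasis 0 S.retraction S.basisVector :=
  isRetractionalBasis_of_separated lattice_separated S.isRetractionSystem fun _ => rfl

end LatticeGrowth

/-! ### Conditionality -/

section PlanePoint

variable {d : ℕ∞}

/-- The point `(a, b, 0, 0, …)` of a lattice of dimension at least two. -/
def planePoint (hd : 2 ≤ d) (a b : ℕ) : lattice d :=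
  ⟨{ toFun := fun i => if i = 0 then a else if i = 1 then b else 0
     continuous_toFun := continuous_of_discreteTopology
     zero_at_infty' := by
      rw [Filter.cocompact_eq_cofinite, Nat.cofinite_eq_atTop]
      refine tendsto_const_nhds.congr' (Filter.eventually_atTop.2 ⟨2, fun i hi => ?_⟩)
      change (0 : ℝ) = if i = 0 then (a : ℝ) else if i = 1 then (b : ℝ) else 0
      rw [if_neg (by omega), if_neg (by omega)] },
   fun i => ⟨if i = 0 then a else if i = 1 then b else 0, by
    change (if i = 0 then (a : ℝ) else if i = 1 then (b : ℝ) else 0) = _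
    split_ifs <;> simp⟩,
   fun i hi => by
    have h2 : 2 ≤ i := by exact_mod_cast hd.trans hi
    change (if i = 0 then (a : ℝ) else if i = 1 then (b : ℝ) else 0) = _
    rw [if_neg (by omega), if_neg (by omega)]⟩

variable (hd : 2 ≤ d)

theorem planePoint_apply (a b i : ℕ) :
    (planePoint hd a b).1 i = if i = 0 then (a : ℝ) else if i = 1 then (b : ℝ) else 0 := rfl

theorem planePoint_inj {a b a' b' : ℕ} :
    planePoint hd a b = planePoint hd a' b' ↔ a = a' ∧ b = b' := by
  refine ⟨fun h => ?_, fun ⟨h, h'⟩ => by rw [h, h']⟩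
  have key : ∀ i, (planePoint hd a b).1 i = (planePoint hd a' b').1 i := fun i => by rw [h]
  exact ⟨by simpa [planePoint_apply] using key 0, by simpa [planePoint_apply] using key 1⟩

theorem planePoint_zero : planePoint hd 0 0 = 0 :=
  lattice_ext fun i => by
    rw [planePoint_apply]
    change _ = (0 : ℝ)
    simp

theorem dist_planePoint_le (a : ℕ) : dist (planePoint hd a 0) (planePoint hd a 1) ≤ 1 := by
  refine dist_le_of_forall zero_le_one fun i => ?_
  rw [planePoint_apply, planePoint_apply]
  split_ifs <;> simp

end PlanePoint

namespace LatticeGrowth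

variable {d : ℕ∞} (S : LatticeGrowth d) (hd : 2 ≤ d)

theorem boxRetraction_planePoint (s a b : ℕ) : S.boxRetraction s (planePoint hd a b) =
    planePoint hd (min (S.hi s 0) a) (min (S.hi s 1) b) := by
  refine lattice_ext fun i => ?_
  rw [boxRetraction, clamp_apply, planePoint_apply, planePoint_apply]
  have hlo : -(S.lo s i : ℝ) ≤ 0 := neg_nonpos.2 (Nat.cast_nonneg _)
  split_ifs with h0 h1
  · rw [h0] at hlo ⊢
    rw [max_eq_right (hlo.trans (by positivity)), Nat.cast_min]
  · rw [h1] at hlo ⊢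
    rw [max_eq_right (hlo.trans (by positivity)), Nat.cast_min]
  · rw [min_eq_right (Nat.cast_nonneg _), max_eq_right hlo]

include hd in
/-- Since faces move by at most one layer in a step, the upper faces of the boxes in the direction
of the first axis take every position. -/
theorem exists_hi_eq (i : ℕ) : ∃ t, S.hi t 0 = i := by
  classical
  have hex : ∃ t, i ≤ S.hi t 0 := by
    obtain ⟨t, ht⟩ := S.exhausts (planePoint hd i 0)
    have := (planePoint_inj hd).1 ((S.boxRetraction_planePoint hd t i 0).symm.trans ht)
    exact ⟨t, min_eq_right_iff.1 this.1⟩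
  have hspec := Nat.find_spec hex
  refine ⟨Nat.find hex, ?_⟩
  rcases ht : Nat.find hex with _ | t
  · rw [ht, S.hi_zero] at hspec
    rw [S.hi_zero]
    omega
  · have hmin : ¬ i ≤ S.hi t 0 := Nat.find_min hex (by omega)
    rw [ht] at hspec
    have := (S.hi_step t 0).2
    omega

include hd in
theorem exists_one_le_hi : ∃ t, 1 ≤ S.hi t 1 := by
  obtain ⟨t, ht⟩ := S.exhausts (planePoint hd 0 1)
  have := (planePoint_inj hd).1 ((S.boxRetraction_planePoint hd t 0 1).symm.trans ht)
  exact ⟨t, min_eq_right_iff.1 this.2⟩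

/-- On the first axis, the retraction that precedes the listing of a point moves it back by one. -/
theorem retraction_axis {i n : ℕ} (hn : S.point (n + 1) = planePoint hd (i + 1) 0) :
    S.retraction n (planePoint hd (i + 1) 0) = planePoint hd i 0 := by
  obtain ⟨t, ht⟩ := S.exists_hi_eq hd i
  have hπ : ∀ j, S.boxRetraction t (planePoint hd j 0) = planePoint hd (min i j) 0 := fun j => by
    rw [S.boxRetraction_planePoint, ht, min_eq_right (Nat.zero_le _)]
  have hmem : planePoint hd i 0 ∈ S.point '' Set.Iic n := by
    obtain ⟨m, hm⟩ := S.bijective.2 (planePoint hd i 0)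
    refine ⟨m, Set.mem_Iic.2 (not_lt.1 fun hnm => ?_), hm⟩
    have := S.boxRetraction_point_of_le (s := t) (Nat.succ_le_of_lt hnm) (by rw [hm, hπ, min_self])
    rw [hn, hπ, planePoint_inj] at this
    omega
  obtain ⟨⟨u, hu⟩, hret, hspec⟩ := S.retraction_spec n (planePoint hd (i + 1) 0)
  have h1 := hspec t (by rwa [hπ, min_eq_left i.le_succ])
  rw [S.boxRetraction_planePoint, min_eq_right (Nat.zero_le _)] at hu
  rw [hu] at h1 hret ⊢
  rw [hπ, hπ, planePoint_inj] at h1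
  have h2 : min (S.hi u 0) (i + 1) ≠ i + 1 := fun h => by
    rw [h, ← hn] at hret
    obtain ⟨m, hm, hmn⟩ := hret
    have := S.bijective.1 hmn
    have := Set.mem_Iic.1 hm
    omega
  rw [planePoint_inj]
  omega

include hd in
/-- The path from the origin to `(k, 0)` runs through all points `(i, 0)` with `i ≤ k`. From the
first box that has height `1` on, the path to the neighbour `(k, 1)` has left the first axis, so
that it misses all but boundedly many of these points. On the basis vectors that belong to them the
indicator function of the points `(i, 0)` with odd `i` is `±1`. -/
theorem not_isUnconditionalBasis : ¬ IsUnconditionalBasis S.basisVector := by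
  classical
  have h0 : (0 : lattice d) ∉ {z : lattice d | ∃ i, Odd i ∧ z = planePoint hd i 0} := by
    rintro ⟨i, hi, h⟩
    rw [← planePoint_zero hd, planePoint_inj] at h
    rw [← h.1] at hi
    exact absurd hi (by decide)
  refine not_isUnconditionalBasis_of_separated lattice_separated S.isRetractionSystem
    (fun _ => rfl) (Lip0.indicator lattice_separated _ h0) 1 fun N => ?_
  obtain ⟨s, hs⟩ := S.exists_one_le_hi hd
  choose ν hν using fun i => S.bijective.2 (planePoint hd i 0)
  have hνpos : ∀ i, ν (i + 1) - 1 + 1 = ν (i + 1) := fun i => by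
    refine Nat.sub_add_cancel (Nat.one_le_iff_ne_zero.2 fun h => ?_)
    have := hν (i + 1)
    rw [h, S.point_zero, ← planePoint_zero hd, planePoint_inj] at this
    omega
  have hνinj : Function.Injective ν := fun i j hij => by
    have := (hν i).symm.trans ((congrArg S.point hij).trans (hν j))
    exact ((planePoint_inj hd).1 this).1
  -- the points `(i + 1, 0)` with `S.hi s 0 ≤ i < k` are missed by the path to `(k, 1)`
  set k := S.hi s 0 + N with hk
  refine ⟨planePoint hd k 0, planePoint hd k 1, dist_planePoint_le hd k,
    (Finset.Ico (S.hi s 0) k).image fun i => ν (i + 1) - 1, ?_, fun n hn => ?_⟩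
  · rw [Finset.card_image_of_injective _ fun i j hij => ?_]
    · simp [hk]
    · have hij : ν (i + 1) - 1 = ν (j + 1) - 1 := hij
      have := hνinj ((hνpos i).symm.trans ((congrArg (· + 1) hij).trans (hνpos j)))
      omega
  · obtain ⟨i, hi, rfl⟩ := Finset.mem_image.1 hn
    rw [Finset.mem_Ico] at hi
    have hpt : S.point (ν (i + 1) - 1 + 1) = planePoint hd (i + 1) 0 := by rw [hνpos, hν]
    rw [hpt]
    refine ⟨?_, ?_, fun h => ?_⟩
    · rw [S.retraction_axis hd hpt, Lip0.indicator_apply, Lip0.indicator_apply]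
      have hodd : ∀ j, (planePoint hd j 0 ∈
          {z : lattice d | ∃ i, Odd i ∧ z = planePoint hd i 0}) ↔ Odd j := fun j => by
        simp [planePoint_inj]
      rw [if_congr (hodd _) rfl rfl, if_congr (hodd _) rfl rfl]
      rcases Nat.even_or_odd i with h | h
      · rw [if_pos h.add_one, if_neg (Nat.not_odd_iff_even.2 h)]; simp
      · rw [if_neg (Nat.not_odd_iff_even.2 h.add_one), if_pos h]; simp
    · obtain ⟨t, ht⟩ := S.exists_hi_eq hd (i + 1)
      rw [← hpt]
      refine S.retraction_eq_point (t := t) ?_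
      rw [hpt, S.boxRetraction_planePoint, planePoint_inj]
      omega
    · obtain ⟨⟨t, ht⟩, -, -⟩ := S.retraction_spec (ν (i + 1) - 1 + 1) (planePoint hd k 1)
      rw [ht, S.boxRetraction_planePoint, planePoint_inj] at h
      rcases le_total s t with hst | hst
      · have : S.hi s 1 ≤ S.hi t 1 := S.hi_mono 1 hst
        omega
      · have : S.hi t 0 ≤ S.hi s 0 := S.hi_mono 0 hst
        omega

include hd in
theorem isConditionalBasis : IsConditionalBasis S.basisVector := by
  obtain ⟨b, hb, -⟩ := S.isRetractionalBasis
  exact ⟨⟨b, hb⟩, S.not_isUnconditionalBasis hd⟩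

end LatticeGrowth

/-! ### Existence of lattice growths -/

/-- A countably infinite type can be enumerated in the order of a rank function with finite
sublevel sets. -/
theorem exists_bijective_monotone {α : Type*} [Infinite α] (r : α → ℕ)
    (hr : ∀ s, {x | r x ≤ s}.Finite) :
    ∃ g : ℕ → α, Function.Bijective g ∧ Monotone fun n => r (g n) := by
  have : Countable α := by
    rw [← Set.countable_univ_iff]
    refine (Set.countable_iUnion fun s => (hr s).countable).mono fun x _ => ?_
    exact Set.mem_iUnion.2 ⟨r x, le_refl (r x)⟩
  obtain ⟨c, hc⟩ := exists_injective_nat α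
  choose B hB using fun s => ((hr s).image c).bddAbove
  have hcB : ∀ x, c x ≤ B (r x) := fun x => hB (r x) ⟨x, le_refl (r x), rfl⟩
  -- The codes of the points of rank `s` are shifted beyond all codes of points of lower rank.
  let F : α → ℕ := fun x => ∑ s ∈ Finset.range (r x), (B s + 1) + c x
  have hF : ∀ x y, r x < r y → F x < F y := fun x y h => by
    have h1 : ∑ s ∈ Finset.range (r x + 1), (B s + 1) ≤ ∑ s ∈ Finset.range (r y), (B s + 1) :=
      Finset.sum_le_sum_of_subset (Finset.range_mono h)
    rw [Finset.sum_range_succ] at h1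
    have := hcB x
    simp only [F]
    omega
  have hinj : Function.Injective F := fun x y h => by
    rcases lt_trichotomy (r x) (r y) with hlt | heq | hlt
    · exact absurd h (hF x y hlt).ne
    · refine hc ?_
      simp only [F, heq] at h
      omega
    · exact absurd h (hF y x hlt).ne'
  have : Infinite (Set.range F) := (Set.infinite_range_of_injective hinj).to_subtype
  classical
  let G := Nat.Subtype.orderIsoOfNat (Set.range F)
  let E := Equiv.ofInjective F hinj
  refine ⟨fun n => E.symm (G n), E.symm.bijective.comp G.bijective, fun m n hmn => ?_⟩
  have hval : ∀ n, F (E.symm (G n)) = (G n : ℕ) := fun n =>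
    congrArg Subtype.val (E.apply_symm_apply (G n))
  refine not_lt.1 fun hlt => ?_
  have h1 := hF _ _ hlt
  rw [hval, hval] at h1
  exact absurd (G.monotone hmn) (not_le.2 h1)

theorem exists_clamp_sub_eq {d : ℕ∞} (x : lattice d) :
    ∃ s, clamp (fun i => s - i) (fun i => s - i) x = x := by
  have h0 : Filter.Tendsto x.1 Filter.atTop (nhds 0) := by
    have := zero_at_infty x.1
    rwa [Filter.cocompact_eq_cofinite, Nat.cofinite_eq_atTop] at this
  have h1 : ∀ᶠ i in Filter.atTop, |x.1 i| < 1 := by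
    have := h0.abs
    rw [abs_zero] at this
    exact this.eventually_lt_const one_pos
  obtain ⟨n, hn⟩ := Filter.eventually_atTop.1 h1
  have hx0 : ∀ i, n ≤ i → x.1 i = 0 := fun i hi => by
    obtain ⟨k, hk⟩ := x.2.1 i
    have h := hn i hi
    rw [hk] at h ⊢
    have : |k| < 1 := by exact_mod_cast h
    rw [Int.abs_lt_one_iff.1 this, Int.cast_zero]
  obtain ⟨m, hm⟩ := exists_nat_ge ‖x.1‖
  refine ⟨n + m, lattice_ext fun i => ?_⟩
  rw [clamp_apply]
  rcases le_total n i with hi | hi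
  · simp [hx0 i hi]
  · have hxi : |x.1 i| ≤ m := le_trans (x.1.toBCF.norm_coe_le_norm i) hm
    have hsub : (m : ℝ) ≤ ((n + m - i : ℕ) : ℝ) := by
      exact_mod_cast (by omega : m ≤ n + m - i)
    obtain ⟨h3, h4⟩ := abs_le.1 hxi
    rw [min_eq_right (by linarith), max_eq_right (by linarith)]

theorem finite_clamp_sub_eq (d : ℕ∞) (s : ℕ) :
    {x : lattice d | clamp (fun i => s - i) (fun i => s - i) x = x}.Finite := by
  have hbd : ∀ x : lattice d, clamp (fun i => s - i) (fun i => s - i) x = x →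
      ∀ i, -((s - i : ℕ) : ℝ) ≤ x.1 i ∧ x.1 i ≤ ((s - i : ℕ) : ℝ) := fun x hx i => by
    rw [← hx, clamp_apply]
    have h : (0 : ℝ) ≤ ((s - i : ℕ) : ℝ) := Nat.cast_nonneg _
    exact ⟨le_max_left _ _, max_le (by linarith) (min_le_left _ _)⟩
  refine Set.Finite.of_injOn (f := fun (x : lattice d) (i : Fin s) => ⌊x.1 i⌋)
    (t := Set.Icc (fun _ => -(s : ℤ)) fun _ => (s : ℤ)) (fun x hx => ⟨fun i => ?_, fun i => ?_⟩)
    (fun x hx y hy hxy => lattice_ext fun i => ?_) (Set.finite_Icc _ _)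
  · have h := (hbd x hx i).1
    have h' : ((s - i : ℕ) : ℝ) ≤ s := by exact_mod_cast Nat.sub_le s i
    refine Int.le_floor.2 ?_
    push_cast
    linarith
  · have h := (hbd x hx i).2
    have h' : ((s - i : ℕ) : ℝ) ≤ s := by exact_mod_cast Nat.sub_le s i
    have := (Int.floor_le (x.1 i)).trans (h.trans h')
    exact_mod_cast this
  · rcases lt_or_ge i s with hi | hi
    · have h := congrFun hxy ⟨i, hi⟩
      obtain ⟨k, hk⟩ := x.2.1 i
      obtain ⟨l, hl⟩ := y.2.1 i
      simp only [hk, hl, Int.floor_intCast] at h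
      rw [hk, hl, h]
    · have hx' := hbd x hx i
      have hy' := hbd y hy i
      rw [Nat.sub_eq_zero_of_le hi] at hx' hy'
      simp only [Nat.cast_zero, neg_zero] at hx' hy'
      linarith [hx'.1, hx'.2, hy'.1, hy'.2]

/-- The boxes `{x | ∀ i, |x i| ≤ max (s - i) 0}` are finite and exhaust the lattice, and so can be
listed one after the other. -/
theorem nonempty_latticeGrowth {d : ℕ∞} (hd : 2 ≤ d) : Nonempty (LatticeGrowth d) := by
  classical
  have : Infinite (lattice d) := Infinite.of_injective (fun i => planePoint hd i 0)
    fun i j h => ((planePoint_inj hd).1 h).1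
  let r : lattice d → ℕ := fun x => Nat.find (exists_clamp_sub_eq x)
  have hr : ∀ s x, r x ≤ s ↔ clamp (fun i => s - i) (fun i => s - i) x = x := fun s x => by
    refine ⟨fun h => ?_, fun h => Nat.find_min' _ h⟩
    have hspec : clamp (fun i => r x - i) (fun i => r x - i) x = x :=
      Nat.find_spec (exists_clamp_sub_eq x)
    rw [← hspec]
    exact clamp_clamp_of_ge (fun i => Nat.sub_le_sub_right h i)
      (fun i => Nat.sub_le_sub_right h i) x
  obtain ⟨g, hg, hmono⟩ := exists_bijective_monotone r fun s => by
    simp only [hr]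
    exact finite_clamp_sub_eq d s
  exact ⟨{
    lo := fun s i => s - i
    hi := fun s i => s - i
    lo_zero := fun i => Nat.zero_sub i
    hi_zero := fun i => Nat.zero_sub i
    lo_step := fun s i => by omega
    hi_step := fun s i => by omega
    exhausts := exists_clamp_sub_eq
    point := g
    bijective := hg
    order := fun s m n hmn h => (hr s _).1 ((hmono hmn).trans ((hr s _).2 h)) }⟩

/-! ### Hájek–Novotný bases -/

/-- Linear isomorphisms and scalings preserve conditional bases, so that only the bases of the
lattices matter. -/
theorem IsHajekNovotnyBasis.isConditionalBasis {d : ℕ∞} (hd : 2 ≤ d) {N : Type*} [MetricSpace N]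
    {p : N} {e : ℕ → LipFree p} (h : IsHajekNovotnyBasis d p e) : IsConditionalBasis e := by
  obtain ⟨S, T, c, hc⟩ := h
  rw [funext fun n => (hc n).2]
  -- The spaces are named because `T` is continuous for the subtype topologies, which have to be
  -- unfolded to be recognized as the norm topologies.
  exact IsConditionalBasis.map (X := LipFree (0 : lattice d)) (Y := LipFree p)
    (S.isConditionalBasis hd) T c fun n => (hc n).1

end FreeBasis

theorem mainTheorem6 :
    -- the integer lattices of dimension at least two, finite or infinite, in `c₀`
    (∀ d : ℕ∞, 2 ≤ d → Nonempty (FreeBasis.LatticeGrowth d) ∧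
      ∀ S : FreeBasis.LatticeGrowth d,
        FreeBasis.IsRetractionSystem 0 S.point S.retraction ∧
        FreeBasis.IsRetractionalBasis 0 S.retraction S.basisVector ∧
        FreeBasis.IsConditionalBasis S.basisVector) ∧
    -- nets in `C(K)`
    (∀ (K : Type*) [TopologicalSpace K] [CompactSpace K] [TopologicalSpace.MetrizableSpace K]
      [Nontrivial K] (N : Set C(K, ℝ)), FreeBasis.IsNet N →
      ∀ (p : N) (e : ℕ → FreeBasis.LipFree p),
        FreeBasis.IsHajekNovotnyBasis (ENat.card K) p e → FreeBasis.IsConditionalBasis e) ∧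
    -- nets in the positive cone of `c₀`
    (∀ N : Set FreeBasis.C0Pos, FreeBasis.IsNet N →
      ∀ (p : N) (e : ℕ → FreeBasis.LipFree p),
        FreeBasis.IsHajekNovotnyBasis ⊤ p e → FreeBasis.IsConditionalBasis e) := by
  refine ⟨fun d hd => ⟨FreeBasis.nonempty_latticeGrowth hd, fun S =>
    ⟨S.isRetractionSystem, S.isRetractionalBasis, S.isConditionalBasis hd⟩⟩, ?_, ?_⟩
  · intro K _ _ _ _ N _ p e he
    refine he.isConditionalBasis ?_
    have h : 1 < ENat.card K := ENat.one_lt_card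
    exact Order.add_one_le_of_lt h
  · intro N _ p e he
    exact he.isConditionalBasis le_top
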